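/- Let $G=(V,E)$ be a directed graph on a finite set $V$ of $p\ge 2$ nodes that has a self-loop at every node, has no directed cycles other than self-loops, and has no isolated nodes (every node is joined by an edge to some other node). Let $\mathbb{R}^E_{\mathrm{stab}}$ be the set of real $V\times V$ matrices $A=(a_{ji})$ with $a_{ji}=0$ whenever $i\to j\notin E$ and with all complex eigenvalues of absolute value $<1$, and let $$\Theta=\mathbb{R}^E_{\mathrm{stab}}\times\mathbb{R}_{>0}^V\times(\mathbb{R}\setminus\{0\})^V\times\mathbb{R}_{>0}^V\subseteq\mathbb{R}^E\times\mathbb{R}^V\times\mathbb{R}^V\times\mathbb{R}^V .$$ For $\theta=(A,\omega^{(2)},\omega^{(3)},\omega^{(4)})\in\Theta$ let $\Omega^{(n)}$ be the diagonal tensor of order $n$ with diagonal $\omega^{(n)}$, and put $\varphi(\theta)=(T_2,T_3,T_4)$, where $$T_n=\sum_{l=0}^{\infty}\Omega^{(n)}\times_1A^l\times_2\cdots\times_nA^l,\qquad (\Omega\times_1B\times_2\cdots\times_nB)_{j_1\dots j_n}=\sum_{i_1,\dots,i_n\in V}\Omega_{i_1\dots i_n}b_{j_1i_1}\cdots b_{j_ni_n}.$$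 A proper algebraic subset of a set $X$ in real affine space is a subset of the form $\{x\in X: g(x)=0\text{ for all }g\in I\}\ne X$, where $I$ is a set of real polynomials. Then the matrix $A$ is generically rationally identifiable from the cumulants $(T_2,T_3,T_4)$, that is: 1. there is a proper algebraic subset $Z$ of $\Theta$ such that for all $\theta\in\Theta\setminus Z$ and all $\theta'\in\Theta$ with $\varphi(\theta')=\varphi(\theta)$, the parameters $\theta$ and $\theta'$ have the same matrix $A$; 2. there are a proper algebraic subset $Q$ of $\varphi(\Theta)$ and, for every entry of $A$, a quotient of two real polynomials in the entries of $(T_2,T_3,T_4)$, such that for every $\theta\in\Theta$ with $\varphi(\theta)\notin Q$ all the denominators are nonzero at $\varphi(\theta)$ and the quotients evaluated at $\varphi(\theta)$ are the entries of $A$. Moreover, the whole parameter $\theta=(A,\Omega^{(2)},\Omega^{(3)},\Omega^{(4)})$ is generically rationally identifiable in the same sense: 1 and 2 hold with all the coordinates of $\theta$ in place of the entries of $A$; in particular, $\varphi^{-1}(\varphi(\theta))=\{\theta\}$ for all $\theta\in\Theta$ outside a proper algebraic subset. -/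

import Mathlib

namespace DiscreteLyapunov

variable {V : Type*}

/-! ### Directed graphs (an edge `i → j` is `G.Adj i j`; self-loops are allowed) -/

/-- `G` has no directed cycle other than self-loops. -/
def AcyclicUpToLoops (G : Digraph V) : Prop :=
  ∀ i, ¬ Relation.TransGen (fun a b => a ≠ b ∧ G.Adj a b) i i

/-- `G` is a DAG with a self-loop at every node. -/
def IsDAGWithAllSelfLoops (G : Digraph V) : Prop :=
  AcyclicUpToLoops G ∧ ∀ i, G.Adj i i

/-- Every node is joined by an edge to some other node. -/
def NoIsolatedNodes (G : Digraph V) : Prop :=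
  ∀ i, ∃ j, j ≠ i ∧ (G.Adj i j ∨ G.Adj j i)

/-! ### Tensors and discrete Lyapunov equations -/

/-- Real tensors of order `n` on `ℝ^V`. -/
abbrev Tensor (V : Type*) (n : ℕ) := (Fin n → V) → ℝ

/-- The Tucker product `T ×₁ A ×₂ A ⋯ ×ₙ A`. -/
def tucker [Fintype V] {n : ℕ} (T : Tensor V n) (A : Matrix V V ℝ) : Tensor V n :=
  fun j => ∑ i : Fin n → V, T i * ∏ k, A (j k) (i k)

open Classical in
/-- The diagonal tensor of order `n` with diagonal entries `w`. -/
noncomputable def diagTensor {n : ℕ} [Fintype V] (w : V → ℝ) : Tensor V n :=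
  fun i => ∑ v, if ∀ k, i k = v then w v else 0

/-- All complex eigenvalues of `A` have absolute value strictly less than one. -/
def SchurStable [Fintype V] [DecidableEq V] (A : Matrix V V ℝ) : Prop :=
  ∀ μ ∈ spectrum ℂ (A.map (algebraMap ℝ ℂ)), ‖μ‖ < 1

/-- The solution `∑ₗ Ω ×₁ Aˡ ×₂ ⋯ ×ₙ Aˡ` of the `n`-th order discrete Lyapunov equation;
the series converges absolutely when `A` is Schur stable. -/
noncomputable def lyapunovCumulant [Fintype V] [DecidableEq V] {n : ℕ}
    (A : Matrix V V ℝ) (Ω : Tensor V n) : Tensor V n :=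
  fun i => ∑' l : ℕ, tucker Ω (A ^ l) i

/-! ### The fourth-order discrete Lyapunov model of `G` -/

/-- Coordinates of the parameter space: one weight for every edge `i → j` and the diagonal
entries of the noise cumulants of orders two, three and four. -/
inductive ParamIdx (G : Digraph V) : Type _
  | edge (i j : V) (h : G.Adj i j)
  | noise2 (i : V)
  | noise3 (i : V)
  | noise4 (i : V)

/-- Coordinates of the space of triples `(S, T, R)` of tensors of orders two, three, four. -/
inductive CumulantIdx (V : Type*) : Type _
  | second (i : Fin 2 → V)
  | third (i : Fin 3 → V)
  | fourth (i : Fin 4 → V)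

open Classical in
/-- The matrix `A ∈ ℝ^E`: its `(j, i)` entry is the weight of the edge `i → j`, and it is `0` if
`i → j` is not an edge. -/
noncomputable def edgeMatrix {G : Digraph V} (θ : ParamIdx G → ℝ) : Matrix V V ℝ :=
  Matrix.of fun j i => if h : G.Adj i j then θ (.edge i j h) else 0

/-- The parameter space `ℝ^E_stab × ℝ₊^V × (ℝ ∖ {0})^V × ℝ₊^V`. -/
def paramSpace [Fintype V] [DecidableEq V] (G : Digraph V) : Set (ParamIdx G → ℝ) :=
  {θ | SchurStable (edgeMatrix θ) ∧ (∀ i, 0 < θ (.noise2 i)) ∧ (∀ i, θ (.noise3 i) ≠ 0) ∧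
    ∀ i, 0 < θ (.noise4 i)}

/-- The map `(A, Ω⁽²⁾, Ω⁽³⁾, Ω⁽⁴⁾) ↦ (S, T, R)`. -/
noncomputable def cumulantMap [Fintype V] [DecidableEq V] (G : Digraph V)
    (θ : ParamIdx G → ℝ) : CumulantIdx V → ℝ
  | .second i => lyapunovCumulant (edgeMatrix θ) (diagTensor fun v => θ (.noise2 v)) i
  | .third i => lyapunovCumulant (edgeMatrix θ) (diagTensor fun v => θ (.noise3 v)) i
  | .fourth i => lyapunovCumulant (edgeMatrix θ) (diagTensor fun v => θ (.noise4 v)) i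

/-! ### Identifiability -/

/-- `Z` is a proper algebraic subset of `X`, a subset of real affine space: it is cut out in `X`
by polynomial equations and differs from `X`. -/
def IsProperAlgebraicSubset {σ : Type*} (X Z : Set (σ → ℝ)) : Prop :=
  ∃ I : Set (MvPolynomial σ ℝ), Z = {x ∈ X | ∀ g ∈ I, MvPolynomial.eval x g = 0} ∧ Z ≠ X

/-- The quantity `q` of the parameter is generically identifiable in the model `f '' Θ`: outside
a proper algebraic subset of `Θ`, all parameters in the fibre of `f` through `θ` have the same
value of `q` as `θ`. For `q = id` this says that the fibre is `{θ}`. -/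
def GenericallyIdentifiable {σ τ β : Type*} (Θ : Set (σ → ℝ)) (f : (σ → ℝ) → (τ → ℝ))
    (q : (σ → ℝ) → β) : Prop :=
  ∃ Z, IsProperAlgebraicSubset Θ Z ∧ ∀ θ ∈ Θ \ Z, ∀ θ' ∈ Θ, f θ' = f θ → q θ' = q θ

/-- The real vector-valued quantity `q` is generically rationally identifiable: it is generically
identifiable and, for all points `y = f θ` of the model `f '' Θ` outside a proper algebraic subset,
every entry of `q θ` is the value at `y` of a fixed rational function, defined at `y`. -/
def GenericallyRationallyIdentifiable {σ τ κ : Type*} (Θ : Set (σ → ℝ))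
    (f : (σ → ℝ) → (τ → ℝ)) (q : (σ → ℝ) → (κ → ℝ)) : Prop :=
  GenericallyIdentifiable Θ f q ∧
  ∃ num den : κ → MvPolynomial τ ℝ, ∃ Q, IsProperAlgebraicSubset (f '' Θ) Q ∧
    ∀ θ ∈ Θ, f θ ∉ Q → ∀ k, MvPolynomial.eval (f θ) (den k) ≠ 0 ∧
      q θ k = MvPolynomial.eval (f θ) (num k) / MvPolynomial.eval (f θ) (den k)

end DiscreteLyapunov

/-! The rows of `A` are recovered recursively along the DAG, using only division. Regular functions
on `Θ` form an integral domain because `Θ` is Zariski dense; those that are rational in the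
cumulants form a subalgebra closed under division by nonzero members
(`mem_rationalInValues_of_mul`). A divisor may thus be tested at a single parameter, here a matrix
supported on the diagonal and one edge.

At index `(j, x, …, x)` with `j ≠ x` the noise drops out, and the Lyapunov equation is linear in row
`j`, with coefficients given by the cumulant and row `x`. If `j` has parents whose rows are known,
the second-order equations at the parents `x` are one too few, because of the self-loop of `j`; a
third-order equation at one parent completes the system (`row_mem_identifiableFunctions`). At a
source `v` only the self-loop weight is unknown. A suitable child of `v` gives one equation in each
of the orders 2, 3, 4 with the same two further unknown weights; eliminating these leaves an
equation that determines the loop weight (`source_self_mem_identifiableFunctions`). The diagonal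
equations then give the noise. -/

namespace DiscreteLyapunov

/-! ### Schur stability and decay of matrix powers. -/

section Analysis

variable {V : Type*} [Fintype V] [DecidableEq V]

open Asymptotics Filter

attribute [local instance] Matrix.linftyOpNormedRing Matrix.linftyOpNormedAlgebra

/-- The powers of a Schur stable matrix decay geometrically. -/
theorem SchurStable.exists_isBigO_pow {A : Matrix V V ℝ} (hA : SchurStable A) :
    ∃ r : ℝ, 0 ≤ r ∧ r < 1 ∧ ∀ i j, (fun l : ℕ => (A ^ l) i j) =O[atTop] fun l => r ^ l := by
  cases isEmpty_or_nonempty V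
  · exact ⟨0, le_rfl, one_pos, fun i => isEmptyElim i⟩
  set B : Matrix V V ℂ := A.map (algebraMap ℝ ℂ) with hB
  have hlt : spectralRadius ℂ B < 1 := by
    have := spectrum.spectralRadius_lt_of_forall_lt (A := Matrix V V ℂ) B (r := 1)
      (fun z hz => by simpa [← NNReal.coe_lt_coe] using hA z hz)
    simpa using this
  obtain ⟨r, hr1, hr2⟩ := ENNReal.lt_iff_exists_nnreal_btwn.1 hlt
  -- Gelfand's formula: `‖B ^ l‖ ^ (1 / l)` tends to the spectral radius. The norm is the maximal
  -- absolute row sum, which bounds every entry.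
  have hev := (spectrum.pow_nnnorm_pow_one_div_tendsto_nhds_spectralRadius B).eventually_lt_const hr1
  refine ⟨r, r.2, by exact_mod_cast hr2, fun i j => ?_⟩
  refine IsBigO.of_bound 1 ?_
  filter_upwards [hev, eventually_gt_atTop 0] with l hl hl0
  have h1 : (‖B ^ l‖₊ : ENNReal) ≤ (r : ENNReal) ^ l := by
    have h2 := ENNReal.rpow_le_rpow hl.le (Nat.cast_nonneg l : (0 : ℝ) ≤ l)
    rwa [← ENNReal.rpow_mul, one_div, inv_mul_cancel₀ (by positivity), ENNReal.rpow_one,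
      ENNReal.rpow_natCast] at h2
  have h3 : ‖B ^ l‖₊ ≤ r ^ l := by exact_mod_cast h1
  have h4 : ‖(B ^ l) i j‖₊ ≤ ‖B ^ l‖₊ := by
    rw [Matrix.linfty_opNNNorm_def]
    exact (Finset.single_le_sum (f := fun j => ‖(B ^ l) i j‖₊) (fun _ _ => zero_le)
      (Finset.mem_univ j)).trans
      (Finset.le_sup (f := fun i => ∑ j, ‖(B ^ l) i j‖₊) (Finset.mem_univ i))
  have h5 : (B ^ l) i j = (((A ^ l) i j : ℝ) : ℂ) := by
    have : B ^ l = (A ^ l).map (algebraMap ℝ ℂ) := by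
      rw [hB, ← RingHom.mapMatrix_apply, ← map_pow]
      rfl
    rw [this]; rfl
  have h6 : ‖(B ^ l) i j‖ ≤ (r : ℝ) ^ l := by exact_mod_cast h4.trans h3
  rw [h5, Complex.norm_real] at h6
  simpa [abs_of_nonneg] using h6

/-- A matrix with sufficiently small entries is Schur stable. -/
theorem schurStable_of_abs_lt {A : Matrix V V ℝ}
    (hA : ∀ i j, |A i j| < ((Fintype.card V : ℝ) + 1)⁻¹) : SchurStable A := by
  intro μ hμ
  cases isEmpty_or_nonempty V
  · exact absurd (spectrum.of_subsingleton (R := ℂ) (A.map (algebraMap ℝ ℂ)) ▸ hμ) (by simp)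
  refine (spectrum.norm_le_norm_of_mem (A := Matrix V V ℂ) hμ).trans_lt ?_
  rw [← coe_nnnorm, ← NNReal.coe_one, NNReal.coe_lt_coe, Matrix.linfty_opNNNorm_def,
    Finset.sup_lt_iff (by simp)]
  intro i _
  rw [← NNReal.coe_lt_coe]
  push_cast
  have h : ∀ j, ‖(A.map (algebraMap ℝ ℂ)) i j‖ ≤ ((Fintype.card V : ℝ) + 1)⁻¹ := fun j => by
    simpa using (hA i j).le
  refine (Finset.sum_le_sum fun j _ => h j).trans_lt ?_
  rw [Finset.sum_const, Finset.card_univ, nsmul_eq_mul, ← div_eq_mul_inv, div_lt_one (by positivity)]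
  linarith

end Analysis

/-! ### Tucker products and the discrete Lyapunov equation. -/

section Tucker

variable {V : Type*} [Fintype V] {n : ℕ}

theorem tucker_tucker (T : Tensor V n) (A B : Matrix V V ℝ) :
    tucker (tucker T B) A = tucker T (A * B) := by
  funext j
  simp only [tucker, Matrix.mul_apply, Finset.prod_univ_sum, Finset.mul_sum, Finset.sum_mul,
    Fintype.piFinset_univ]
  rw [Finset.sum_comm]
  refine Finset.sum_congr rfl fun i _ => Finset.sum_congr rfl fun k _ => ?_
  rw [Finset.prod_mul_distrib]
  ring

theorem tucker_one [DecidableEq V] (T : Tensor V n) : tucker T 1 = T := by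
  funext j
  rw [tucker, Finset.sum_eq_single j]
  · simp
  · intro i _ hij
    obtain ⟨k, hk⟩ := Function.ne_iff.1 hij
    rw [Finset.prod_eq_zero (Finset.mem_univ k) (show (1 : Matrix V V ℝ) (j k) (i k) = 0 from
      Matrix.one_apply_ne' hk), mul_zero]
  · simp

theorem diagTensor_const [NeZero n] (w : V → ℝ) (v : V) :
    diagTensor (n := n) w (fun _ => v) = w v := by
  classical
  simp [diagTensor]

theorem diagTensor_of_ne (w : V → ℝ) {i : Fin n → V} {k l : Fin n} (h : i k ≠ i l) :
    diagTensor w i = 0 :=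
  Finset.sum_eq_zero fun _ _ => if_neg fun hv => h ((hv k).trans (hv l).symm)

/-- The matrix of the linear map `T ↦ T ×₁ A ⋯ ×ₙ A`. -/
def tuckerMatrix (n : ℕ) (A : Matrix V V ℝ) : Matrix (Fin n → V) (Fin n → V) ℝ :=
  Matrix.of fun j i => ∏ k, A (j k) (i k)

theorem tuckerMatrix_mulVec (A : Matrix V V ℝ) (T : Tensor V n) :
    (tuckerMatrix n A).mulVec T = tucker T A := by
  funext j
  simp [Matrix.mulVec, dotProduct, tuckerMatrix, tucker, mul_comm]

variable [DecidableEq V]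

theorem SchurStable.summable_tucker [NeZero n] {A : Matrix V V ℝ} (hA : SchurStable A)
    (T : Tensor V n) (i : Fin n → V) : Summable fun l : ℕ => tucker T (A ^ l) i := by
  obtain ⟨r, hr0, hr1, hr⟩ := hA.exists_isBigO_pow
  refine summable_sum fun j _ => Summable.mul_left _ ?_
  have h : (fun l : ℕ => ∏ k, (A ^ l) (i k) (j k)) =O[Filter.atTop]
      fun l => ∏ _k : Fin n, r ^ l := by
    exact Asymptotics.IsBigO.finsetProd fun k _ => hr (i k) (j k)
  refine summable_of_isBigO_nat ?_ h
  simp only [Finset.prod_const, Finset.card_univ, Fintype.card_fin, ← pow_mul, mul_comm _ n]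
  simp only [pow_mul]
  exact summable_geometric_of_lt_one (by positivity) (pow_lt_one₀ hr0 hr1 (NeZero.ne n))

/-- The cumulant tensors solve the discrete Lyapunov equation. -/
theorem SchurStable.lyapunovCumulant_eq [NeZero n] {A : Matrix V V ℝ} (hA : SchurStable A)
    (Ω : Tensor V n) (i : Fin n → V) :
    lyapunovCumulant A Ω i = tucker (lyapunovCumulant A Ω) A i + Ω i := by
  have hs := hA.summable_tucker Ω
  have h1 : tucker (lyapunovCumulant A Ω) A i = ∑' l : ℕ, tucker Ω (A ^ (l + 1)) i := by
    have : ∀ l : ℕ, tucker Ω (A ^ (l + 1)) i = ∑ j, tucker Ω (A ^ l) j * ∏ k, A (i k) (j k) := by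
      intro l
      rw [pow_succ', ← tucker_tucker]
      rfl
    simp only [this]
    rw [Summable.tsum_finsetSum fun j _ => (hs j).mul_right _]
    simp only [tsum_mul_right]
    rfl
  rw [h1, lyapunovCumulant, (hs i).tsum_eq_zero_add, pow_zero, tucker_one, add_comm]

/-- A kernel vector is a tensor `T` fixed by the Tucker product with `A`, hence with every `A ^ l`;
these products tend to zero. -/
theorem SchurStable.det_one_sub_tuckerMatrix_ne_zero [NeZero n] {A : Matrix V V ℝ}
    (hA : SchurStable A) : (1 - tuckerMatrix n A).det ≠ 0 := by
  intro h0
  obtain ⟨T, hT0, hT⟩ := Matrix.exists_mulVec_eq_zero_iff.2 h0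
  rw [Matrix.sub_mulVec, Matrix.one_mulVec, tuckerMatrix_mulVec, sub_eq_zero] at hT
  refine hT0 (funext fun i => ?_)
  have h : ∀ l : ℕ, tucker T (A ^ l) = T := by
    intro l
    induction l with
    | zero => rw [pow_zero, tucker_one]
    | succ l ih => rw [pow_succ', ← tucker_tucker, ih, ← hT]
  have := (hA.summable_tucker T i).tendsto_atTop_zero
  simp only [h] at this
  exact tendsto_nhds_unique tendsto_const_nhds this

/-- Cramer's rule for the Lyapunov equation. It turns the infinite series into a quotient of
polynomials in the parameters. -/
theorem SchurStable.det_mul_lyapunovCumulant [NeZero n] {A : Matrix V V ℝ}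
    (hA : SchurStable A) (Ω : Tensor V n) (i : Fin n → V) :
    (1 - tuckerMatrix n A).det * lyapunovCumulant A Ω i =
      ((1 - tuckerMatrix n A).updateCol i Ω).det := by
  have h : (1 - tuckerMatrix n A).mulVec (lyapunovCumulant A Ω) = Ω := by
    rw [Matrix.sub_mulVec, Matrix.one_mulVec, tuckerMatrix_mulVec]
    funext j
    rw [Pi.sub_apply, hA.lyapunovCumulant_eq Ω j]
    ring
  rw [← Matrix.cramer_apply, ← smul_eq_mul, ← Pi.smul_apply]
  rw [← h, Matrix.cramer_eq_adjugate_mulVec, Matrix.mulVec_mulVec, Matrix.adjugate_mul,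
    Matrix.smul_mulVec, Matrix.one_mulVec, h]

end Tucker

/-! ### Regular functions on `Θ` and rational functions of the values of `f`. -/

section RationalFunctions

open MvPolynomial

/-- Functions on `Θ` that are quotients of polynomials with a denominator that has no zero
in `Θ`. -/
def regularFunctions {σ : Type*} (Θ : Set (σ → ℝ)) : Subalgebra ℝ (Θ → ℝ) where
  carrier := {f | ∃ P D : MvPolynomial σ ℝ, (∀ θ : Θ, eval θ.1 D ≠ 0) ∧
    ∀ θ : Θ, eval θ.1 D * f θ = eval θ.1 P}
  mul_mem' := by
    rintro f g ⟨P, D, hD, h⟩ ⟨P', D', hD', h'⟩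
    refine ⟨P * P', D * D', fun θ => by simp [hD, hD'], fun θ => ?_⟩
    rw [map_mul, map_mul, ← h, ← h', Pi.mul_apply]
    ring
  add_mem' := by
    rintro f g ⟨P, D, hD, h⟩ ⟨P', D', hD', h'⟩
    refine ⟨P * D' + D * P', D * D', fun θ => by simp [hD, hD'], fun θ => ?_⟩
    rw [map_mul, map_add, map_mul, map_mul, ← h, ← h', Pi.add_apply]
    ring
  algebraMap_mem' r := ⟨C r, 1, by simp, by simp⟩

/-- No nonzero polynomial vanishes on `Θ`. -/
def ZariskiDense {σ : Type*} (Θ : Set (σ → ℝ)) : Prop :=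
  ∀ P : MvPolynomial σ ℝ, (∀ θ : Θ, eval θ.1 P = 0) → P = 0

variable {σ τ : Type*} {Θ : Set (σ → ℝ)}

theorem eval_mem_regularFunctions (P : MvPolynomial σ ℝ) :
    (fun θ : Θ => eval θ.1 P) ∈ regularFunctions Θ :=
  ⟨P, 1, by simp, by simp⟩

theorem coord_mem_regularFunctions (s : σ) : (fun θ : Θ => θ.1 s) ∈ regularFunctions Θ := by
  simpa using eval_mem_regularFunctions (Θ := Θ) (X s)

theorem mem_regularFunctions_of_mul {f g : Θ → ℝ} (hg : g ∈ regularFunctions Θ)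
    (hg0 : ∀ θ, g θ ≠ 0) (h : g * f ∈ regularFunctions Θ) : f ∈ regularFunctions Θ := by
  obtain ⟨P, D, hD, h1⟩ := hg
  obtain ⟨P', D', hD', h2⟩ := h
  refine ⟨P' * D, P * D', fun θ => ?_, fun θ => ?_⟩
  · rw [map_mul, ← h1]
    exact mul_ne_zero (mul_ne_zero (hD θ) (hg0 θ)) (hD' θ)
  · rw [map_mul, map_mul, ← h1, ← h2, Pi.mul_apply]
    ring

/-- The numerators multiply to a polynomial vanishing on `Θ`, hence to zero, and the polynomial ring
is a domain. -/
theorem ZariskiDense.mul_eq_zero (hΘ : ZariskiDense Θ) {f g : Θ → ℝ}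
    (hf : f ∈ regularFunctions Θ) (hg : g ∈ regularFunctions Θ) (h : f * g = 0) :
    f = 0 ∨ g = 0 := by
  obtain ⟨P, D, hD, h1⟩ := hf
  obtain ⟨P', D', hD', h2⟩ := hg
  have : P * P' = 0 := hΘ _ fun θ => by
    have := congrFun h θ
    rw [Pi.mul_apply, Pi.zero_apply] at this
    rw [map_mul, ← h1, ← h2, mul_mul_mul_comm, this, mul_zero]
  rcases _root_.mul_eq_zero.1 this with h0 | h0
  · left
    funext θ
    have := h1 θ
    rw [h0, map_zero] at this
    exact (_root_.mul_eq_zero.1 this).resolve_left (hD θ)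
  · right
    funext θ
    have := h2 θ
    rw [h0, map_zero] at this
    exact (_root_.mul_eq_zero.1 this).resolve_left (hD' θ)

theorem ZariskiDense.mul_ne_zero (hΘ : ZariskiDense Θ) {f g : Θ → ℝ}
    (hf : f ∈ regularFunctions Θ) (hg : g ∈ regularFunctions Θ) (hf0 : f ≠ 0) (hg0 : g ≠ 0) :
    f * g ≠ 0 :=
  fun h => (hΘ.mul_eq_zero hf hg h).elim hf0 hg0

variable {f : (σ → ℝ) → (τ → ℝ)}

theorem eval_comp_mem_regularFunctions
    (hf : ∀ t, (fun θ : Θ => f θ t) ∈ regularFunctions Θ) (p : MvPolynomial τ ℝ) :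
    (fun θ : Θ => eval (f θ) p) ∈ regularFunctions Θ := by
  induction p using MvPolynomial.induction_on with
  | C a => simpa only [eval_C] using! (regularFunctions Θ).algebraMap_mem a
  | add p q hp hq => simpa only [map_add] using! add_mem hp hq
  | mul_X p t hp => simpa only [map_mul, eval_X] using! mul_mem hp (hf t)

/-- Regular functions on `Θ` that are rational functions of the values of `f`. -/
def rationalInValues (hΘ : ZariskiDense Θ) (hne : Θ.Nonempty)
    (hf : ∀ t, (fun θ : Θ => f θ t) ∈ regularFunctions Θ) : Subalgebra ℝ (Θ → ℝ) where
  -- The denominator must be nonzero as a function on `Θ`: a nonzero polynomial `d` may vanish on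
  -- the whole image of `f`.
  carrier := {g | g ∈ regularFunctions Θ ∧ ∃ p d : MvPolynomial τ ℝ,
    (fun θ : Θ => eval (f θ) d) ≠ 0 ∧ ∀ θ : Θ, eval (f θ) d * g θ = eval (f θ) p}
  mul_mem' := by
    rintro g g' ⟨hg, p, d, hd, h⟩ ⟨hg', p', d', hd', h'⟩
    refine ⟨mul_mem hg hg', p * p', d * d', ?_, fun θ => ?_⟩
    · simpa only [map_mul] using! hΘ.mul_ne_zero (eval_comp_mem_regularFunctions hf d)
        (eval_comp_mem_regularFunctions hf d') hd hd'
    · rw [map_mul, map_mul, ← h, ← h', Pi.mul_apply]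
      ring
  add_mem' := by
    rintro g g' ⟨hg, p, d, hd, h⟩ ⟨hg', p', d', hd', h'⟩
    refine ⟨add_mem hg hg', p * d' + d * p', d * d', ?_, fun θ => ?_⟩
    · simpa only [map_mul] using! hΘ.mul_ne_zero (eval_comp_mem_regularFunctions hf d)
        (eval_comp_mem_regularFunctions hf d') hd hd'
    · rw [map_mul, map_add, map_mul, map_mul, ← h, ← h', Pi.add_apply]
      ring
  algebraMap_mem' r := ⟨Subalgebra.algebraMap_mem _ r, C r, 1,
    fun h => by simpa using congrFun h ⟨_, hne.some_mem⟩, by simp⟩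

variable {hΘ : ZariskiDense Θ} {hne : Θ.Nonempty}
  {hf : ∀ t, (fun θ : Θ => f θ t) ∈ regularFunctions Θ}

theorem value_mem_rationalInValues (t : τ) :
    (fun θ : Θ => f θ t) ∈ rationalInValues hΘ hne hf :=
  ⟨hf t, X t, 1, fun h => by simpa using congrFun h ⟨_, hne.some_mem⟩, by simp⟩

/-- With `r = p / d` and `r * g = p' / d'`, the quotient is `p' * d / (d' * p)`. Its denominator
equals `d' * d * r` on `Θ`, a product of nonzero elements of a domain. -/
theorem mem_rationalInValues_of_mul {g r : Θ → ℝ} (hg : g ∈ regularFunctions Θ)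
    (hr : r ∈ rationalInValues hΘ hne hf) (hr0 : r ≠ 0)
    (hrg : r * g ∈ rationalInValues hΘ hne hf) : g ∈ rationalInValues hΘ hne hf := by
  obtain ⟨hr', p, d, hd, h⟩ := hr
  obtain ⟨-, p', d', hd', h'⟩ := hrg
  refine ⟨hg, p' * d, d' * p, ?_, fun θ => ?_⟩
  · have := hΘ.mul_ne_zero (eval_comp_mem_regularFunctions hf d')
      (mul_mem (eval_comp_mem_regularFunctions hf d) hr') hd'
      (hΘ.mul_ne_zero (eval_comp_mem_regularFunctions hf d) hr' hd hr0)
    convert this using 1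
    funext θ
    simp [h]
  · rw [map_mul, map_mul, ← h, ← h', Pi.mul_apply]
    ring

theorem det_mem_subalgebra {X ι : Type*} [Fintype ι] [DecidableEq ι] (R : Subalgebra ℝ (X → ℝ))
    {M : X → Matrix ι ι ℝ} (hM : ∀ i j, (fun x => M x i j) ∈ R) : (fun x => (M x).det) ∈ R := by
  have : (fun x => (M x).det) =
      ∑ s : Equiv.Perm ι, ((Equiv.Perm.sign s : ℤ) : ℝ) • ∏ i, fun x => M x (s i) i := by
    funext x
    simp [Matrix.det_apply']
  rw [this]
  exact sum_mem fun s _ => R.smul_mem (prod_mem fun i _ => hM _ _) _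

/-- The solution of a generically nonsingular linear system with coefficients that are rational
in the values of `f` is rational in the values of `f`. -/
theorem mem_rationalInValues_of_mulVec {ι : Type*} [Fintype ι] [DecidableEq ι]
    {M : Θ → Matrix ι ι ℝ} {x b : Θ → ι → ℝ}
    (hM : ∀ i j, (fun θ => M θ i j) ∈ rationalInValues hΘ hne hf)
    (hb : ∀ i, (fun θ => b θ i) ∈ rationalInValues hΘ hne hf)
    (hx : ∀ i, (fun θ => x θ i) ∈ regularFunctions Θ)
    (h : ∀ θ, (M θ).mulVec (x θ) = b θ) {θ₀ : Θ} (h₀ : (M θ₀).det ≠ 0) (i : ι) :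
    (fun θ => x θ i) ∈ rationalInValues hΘ hne hf := by
  refine mem_rationalInValues_of_mul (hx i) (det_mem_subalgebra _ hM)
    (fun h => h₀ (congrFun h θ₀)) ?_
  have : ((fun θ => (M θ).det) * fun θ => x θ i) = fun θ => ((M θ).updateCol i (b θ)).det := by
    funext θ
    have := congrFun (Matrix.cramer_eq_adjugate_mulVec (M θ) (b θ)) i
    rw [← h, Matrix.mulVec_mulVec, Matrix.adjugate_mul, Matrix.smul_mulVec, Matrix.one_mulVec,
      Matrix.cramer_apply, h] at this
    simpa using this.symm
  rw [this]
  refine det_mem_subalgebra _ fun j k => ?_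
  by_cases hk : k = i
  · subst hk
    simpa using hb j
  · simpa [Matrix.updateCol_ne hk] using hM j k

/-- The product of all denominators cuts out the exceptional set in the image; the numerator `P` of
its pullback cuts out the one in `Θ`. -/
theorem genericallyRationallyIdentifiable_of_mem {κ : Type*} [Finite κ]
    {q : (σ → ℝ) → (κ → ℝ)}
    (hq : ∀ k, (fun θ : Θ => q θ k) ∈ rationalInValues hΘ hne hf) :
    GenericallyRationallyIdentifiable Θ f q := by
  cases nonempty_fintype κ
  choose hreg num den hden h using hq
  have hprod : (fun θ : Θ => eval (f θ) (∏ k, den k)) ≠ 0 := by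
    have : ∀ s : Finset κ, (fun θ : Θ => eval (f θ) (∏ k ∈ s, den k)) ≠ 0 := by
      classical
      intro s
      induction s using Finset.induction_on with
      | empty => exact fun h => by simpa using congrFun h ⟨_, hne.some_mem⟩
      | insert k s hk ih =>
        rw [Finset.prod_insert hk]
        simpa only [map_mul] using! hΘ.mul_ne_zero (eval_comp_mem_regularFunctions hf _)
          (eval_comp_mem_regularFunctions hf _) (hden k) ih
    exact this _
  have hval : ∀ θ ∈ Θ, eval (f θ) (∏ k, den k) ≠ 0 → ∀ k, eval (f θ) (den k) ≠ 0 ∧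
      q θ k = eval (f θ) (num k) / eval (f θ) (den k) := by
    intro θ hθ h0 k
    rw [map_prod, Finset.prod_ne_zero_iff] at h0
    have hk := h0 k (Finset.mem_univ k)
    exact ⟨hk, by rw [eq_div_iff hk, mul_comm]; exact h k ⟨θ, hθ⟩⟩
  obtain ⟨P, D, hD, hPD⟩ := eval_comp_mem_regularFunctions hf (∏ k, den k)
  obtain ⟨θ₀, h₀⟩ := Function.ne_iff.1 hprod
  refine ⟨⟨{θ ∈ Θ | ∀ g ∈ ({P} : Set _), eval θ g = 0}, ⟨{P}, rfl, fun hZ => ?_⟩, ?_⟩,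
    num, den, {y ∈ f '' Θ | ∀ g ∈ ({∏ k, den k} : Set _), eval y g = 0},
    ⟨_, rfl, fun hQ => ?_⟩, ?_⟩
  · have := (hZ.symm ▸ θ₀.2 : θ₀.1 ∈ {θ ∈ Θ | ∀ g ∈ ({P} : Set _), eval θ g = 0}).2 P rfl
    rw [← hPD] at this
    exact _root_.mul_ne_zero (hD θ₀) h₀ this
  · rintro θ ⟨hθ, hθZ⟩ θ' hθ' hff
    have h1 : eval (f θ) (∏ k, den k) ≠ 0 := by
      intro h0
      refine hθZ ⟨hθ, fun g hg => ?_⟩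
      rw [Set.mem_singleton_iff.1 hg]
      have := hPD ⟨θ, hθ⟩
      rw [← this]
      simp only [h0, mul_zero]
    funext k
    rw [(hval θ hθ h1 k).2, (hval θ' hθ' (hff ▸ h1) k).2, hff]
  · have := (hQ.symm ▸ Set.mem_image_of_mem f θ₀.2 :
      f θ₀ ∈ {y ∈ f '' Θ | ∀ g ∈ ({∏ k, den k} : Set _), eval y g = 0}).2 _ rfl
    exact h₀ this
  · intro θ hθ hQ
    refine hval θ hθ fun h0 => hQ ⟨Set.mem_image_of_mem f hθ, fun g hg => ?_⟩
    rw [Set.mem_singleton_iff.1 hg, h0]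

end RationalFunctions

/-! ### Lyapunov equations that are linear in one row of `A`. -/

section Contraction

variable {V : Type*} [Fintype V] {m : ℕ}

/-- The contraction of all but the first index of `T` with the row `x` of `A`. -/
def contract (T : Tensor V (m + 1)) (A : Matrix V V ℝ) (x y : V) : ℝ :=
  ∑ i : Fin m → V, T (Fin.cons y i) * ∏ k, A x (i k)

/-- Row `j` enters through the first factor only, so the expression is linear in it once row `x` is
known. -/
theorem tucker_cons (T : Tensor V (m + 1)) (A : Matrix V V ℝ) (j x : V) :
    tucker T A (Fin.cons j fun _ => x) = ∑ y, contract T A x y * A j y := by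
  rw [tucker, ← (Fin.consEquiv fun _ : Fin (m + 1) => V).sum_comp, Fintype.sum_prod_type]
  refine Finset.sum_congr rfl fun y _ => ?_
  rw [contract, Finset.sum_mul]
  refine Finset.sum_congr rfl fun i _ => ?_
  simp [Fin.prod_univ_succ, Fin.consEquiv]
  ring

theorem contract_of_row_eq_zero (T : Tensor V (m + 1)) {A : Matrix V V ℝ} {x : V}
    (hx : ∀ y, y ≠ x → A x y = 0) (y : V) :
    contract T A x y = A x x ^ m * T (Fin.cons y fun _ => x) := by
  rw [contract, Finset.sum_eq_single fun _ => x]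
  · simp [mul_comm]
  · intro i _ hi
    obtain ⟨k, hk⟩ := Function.ne_iff.1 hi
    rw [Finset.prod_eq_zero (Finset.mem_univ k) (hx _ hk), mul_zero]
  · simp

theorem contract_mem_subalgebra {X : Type*} (R : Subalgebra ℝ (X → ℝ)) {m : ℕ}
    {T : X → Tensor V (m + 1)} {A : X → Matrix V V ℝ} (hT : ∀ i, (fun θ => T θ i) ∈ R) {x : V}
    (hA : ∀ y, (fun θ => A θ x y) ∈ R) (y : V) : (fun θ => contract (T θ) (A θ) x y) ∈ R := by
  have : (fun θ => contract (T θ) (A θ) x y) =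
      ∑ i : Fin m → V, (fun θ => T θ (Fin.cons y i)) * ∏ k, fun θ => A θ x (i k) := by
    funext θ
    simp [contract]
  rw [this]
  exact sum_mem fun i _ => mul_mem (hT _) (prod_mem fun k _ => hA _)

/-- `T` solves the discrete Lyapunov equation with matrix `A` and diagonal noise tensor `w`. -/
def IsLyapunovSolution {n : ℕ} (T : Tensor V n) (A : Matrix V V ℝ) (w : V → ℝ) : Prop :=
  ∀ i, T i = tucker T A i + diagTensor w i

variable {T : Tensor V (m + 1)} {A : Matrix V V ℝ} {w : V → ℝ}

theorem IsLyapunovSolution.cons_self (hT : IsLyapunovSolution T A w) (x : V) :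
    T (Fin.cons x fun _ => x) = ∑ y, contract T A x y * A x y + w x := by
  have h : (Fin.cons x fun _ => x : Fin (m + 1) → V) = fun _ => x := by
    funext k
    cases k using Fin.cases <;> rfl
  rw [hT, tucker_cons, h, diagTensor_const]

theorem IsLyapunovSolution.cons_of_ne [NeZero m] (hT : IsLyapunovSolution T A w) {j x : V}
    (h : j ≠ x) : T (Fin.cons j fun _ => x) = ∑ y, contract T A x y * A j y := by
  rw [hT, tucker_cons, diagTensor_of_ne w (k := 0) (l := Fin.succ 0) (by
    rwa [Fin.cons_zero, Fin.cons_succ]), add_zero]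

theorem noise_mem_of_isLyapunovSolution {X : Type*} (R : Subalgebra ℝ (X → ℝ)) {m : ℕ}
    {T : X → Tensor V (m + 1)} {A : X → Matrix V V ℝ} {w : X → V → ℝ}
    (hT : ∀ i, (fun θ => T θ i) ∈ R) (hA : ∀ x y, (fun θ => A θ x y) ∈ R)
    (h : ∀ θ, IsLyapunovSolution (T θ) (A θ) (w θ)) (v : V) : (fun θ => w θ v) ∈ R := by
  have : (fun θ => w θ v) = (fun θ => T θ (Fin.cons v fun _ => v)) -
      ∑ y, (fun θ => contract (T θ) (A θ) v y) * fun θ => A θ v y := by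
    funext θ
    simp [(h θ).cons_self v]
  rw [this]
  exact sub_mem (hT _) (sum_mem fun y _ => mul_mem (contract_mem_subalgebra R hT (hA v) y) (hA v y))

end Contraction

/-! ### Test matrices supported on the diagonal and one edge. -/

section SingleEdge

variable {V : Type*} [DecidableEq V]

/-- A matrix supported on the diagonal and at one edge `u → j`. -/
def singleEdgeMatrix (u j : V) (ε : ℝ) : Matrix V V ℝ :=
  -- The loop at `j` has weight `0`, so row `j` has its only entry at `u` when `u ≠ j`.
  Matrix.of fun x y => if x = y then (if x = j then 0 else ε) else if x = j ∧ y = u then ε else 0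

theorem singleEdgeMatrix_of_ne {u j x y : V} {ε : ℝ} (hx : x ≠ j) (hy : y ≠ x) :
    singleEdgeMatrix u j ε x y = 0 := by
  simp [singleEdgeMatrix, hx, hy.symm]

theorem singleEdgeMatrix_self {u j x : V} {ε : ℝ} (hx : x ≠ j) :
    singleEdgeMatrix u j ε x x = ε := by
  simp [singleEdgeMatrix, hx]

variable [Fintype V]

theorem sum_mul_singleEdgeMatrix {u j x : V} {ε : ℝ} (hx : x ≠ j) (g : V → ℝ) :
    ∑ y, g y * singleEdgeMatrix u j ε x y = g x * ε := by
  rw [Finset.sum_eq_single x, singleEdgeMatrix_self hx]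
  · intro y _ hy
    rw [singleEdgeMatrix_of_ne hx hy, mul_zero]
  · simp

theorem sum_mul_singleEdgeMatrix_target {u j : V} {ε : ℝ} (huj : u ≠ j) (g : V → ℝ) :
    ∑ y, g y * singleEdgeMatrix u j ε j y = g u * ε := by
  rw [Finset.sum_eq_single u]
  · simp [singleEdgeMatrix, huj.symm]
  · intro y _ hy
    simp [singleEdgeMatrix, hy]
  · simp

variable {m : ℕ} {T : Tensor V (m + 1)} {u j : V} {ε : ℝ} {w : V → ℝ}

theorem contract_singleEdgeMatrix (T : Tensor V (m + 1)) {x : V} (hx : x ≠ j) (y : V) :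
    contract T (singleEdgeMatrix u j ε) x y = ε ^ m * T (Fin.cons y fun _ => x) := by
  rw [contract_of_row_eq_zero T (fun y hy => singleEdgeMatrix_of_ne hx hy),
    singleEdgeMatrix_self hx]

theorem IsLyapunovSolution.singleEdge_self_ne_zero
    (hT : IsLyapunovSolution T (singleEdgeMatrix u j ε) w) {x : V} (hx : x ≠ j) (hw : w x ≠ 0) :
    T (Fin.cons x fun _ => x) ≠ 0 := by
  intro h
  have := hT.cons_self x
  rw [sum_mul_singleEdgeMatrix hx, contract_singleEdgeMatrix T hx, h] at this
  apply hw
  linarith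

/-- The exponent of `ε` is the order of the tensor. This dependence makes equations of different
orders independent. -/
theorem IsLyapunovSolution.singleEdge_target [NeZero m]
    (hT : IsLyapunovSolution T (singleEdgeMatrix u j ε) w) (huj : u ≠ j) {x : V} (hx : x ≠ j) :
    T (Fin.cons j fun _ => x) = ε ^ (m + 1) * T (Fin.cons u fun _ => x) := by
  rw [hT.cons_of_ne hx.symm, sum_mul_singleEdgeMatrix_target huj, contract_singleEdgeMatrix T hx]
  ring

theorem IsLyapunovSolution.singleEdge_eq_zero [NeZero m]
    (hT : IsLyapunovSolution T (singleEdgeMatrix u j ε) w) (hε : 0 < ε) (hε1 : ε < 1)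
    {x y : V} (hx : x ≠ j) (hy : y ≠ j) (hxy : y ≠ x) : T (Fin.cons y fun _ => x) = 0 := by
  have h := hT.cons_of_ne hxy
  rw [sum_mul_singleEdgeMatrix hy, contract_singleEdgeMatrix T hx] at h
  have h1 : ε ^ (m + 1) < 1 := pow_lt_one₀ hε.le hε1 (by simp)
  have h2 : (1 - ε ^ (m + 1)) * T (Fin.cons y fun _ => x) = 0 := by
    rw [pow_succ]
    linear_combination h
  exact (mul_eq_zero.1 h2).resolve_left (by linarith)

/-- The linear system for row `j` is nonsingular when `A` is supported on the diagonal and at one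
edge `u → j`. -/
theorem det_rowSystem_singleEdge_ne_zero {S : Tensor V 2} {T : Tensor V 3} {w₂ w₃ : V → ℝ}
    (hS : IsLyapunovSolution S (singleEdgeMatrix u j ε) w₂)
    (hT : IsLyapunovSolution T (singleEdgeMatrix u j ε) w₃) (huj : u ≠ j)
    (hε : 0 < ε) (hε1 : ε < 1) (hw₂ : ∀ x, w₂ x ≠ 0) (hw₃ : ∀ x, w₃ x ≠ 0)
    (p : V → Prop) [DecidablePred p] (hp : p u) :
    (Matrix.of fun x y => if x = j then contract T (singleEdgeMatrix u j ε) u y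
      else if p x then contract S (singleEdgeMatrix u j ε) x y
      else (1 : Matrix V V ℝ) x y).det ≠ 0 := by
  intro h0
  obtain ⟨v, hv0, hv⟩ := Matrix.exists_mulVec_eq_zero_iff.2 h0
  have hrow := fun x => congrFun hv x
  simp only [Matrix.mulVec, dotProduct, Matrix.of_apply, Pi.zero_apply] at hrow
  have hoff : ∀ x, x ≠ j → x ≠ u → v x = 0 := by
    intro x hxj hxu
    have h := hrow x
    simp only [hxj, if_false] at h
    by_cases hpx : p x
    · simp only [hpx, if_true, contract_singleEdgeMatrix S hxj] at h
      rw [Finset.sum_eq_single x] at h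
      · have := hS.singleEdge_self_ne_zero hxj (hw₂ x)
        simpa [hε.ne', this] using h
      · intro y _ hy
        by_cases hyj : y = j
        · rw [hyj, hS.singleEdge_target huj hxj, hS.singleEdge_eq_zero hε hε1 hxj huj hxu.symm]
          ring
        · rw [hS.singleEdge_eq_zero hε hε1 hxj hyj hy]
          ring
      · simp
    · simpa [hpx, Matrix.one_apply] using h
  have hsum : ∀ g : V → ℝ, ∑ y, g y * v y = g u * v u + g j * v j := by
    intro g
    rw [Finset.sum_eq_add u j huj]
    · intro y _ hy
      rw [hoff y hy.2 hy.1, mul_zero]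
    · simp
    · simp
  have h1 := hrow u
  have h2 := hrow j
  simp only [huj, hp, if_true, if_false, hsum, contract_singleEdgeMatrix _ huj,
    hS.singleEdge_target huj huj, hT.singleEdge_target huj huj] at h1 h2
  have hSu := hS.singleEdge_self_ne_zero huj (hw₂ u)
  have hTu := hT.singleEdge_self_ne_zero huj (hw₃ u)
  -- After scaling, rows `u` and `j` have coefficients `(1, ε ^ 2)` and `(1, ε ^ 3)`, which are
  -- independent since `0 < ε < 1`.
  have h1' : v u + ε ^ 2 * v j = 0 := by
    have : ε * S (Fin.cons u fun _ => u) * (v u + ε ^ 2 * v j) = 0 := by linear_combination h1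
    exact (mul_eq_zero.1 this).resolve_left (mul_ne_zero hε.ne' hSu)
  have h2' : v u + ε ^ 3 * v j = 0 := by
    have : ε ^ 2 * T (Fin.cons u fun _ => u) * (v u + ε ^ 3 * v j) = 0 := by
      linear_combination h2
    exact (mul_eq_zero.1 this).resolve_left (mul_ne_zero (pow_ne_zero 2 hε.ne') hTu)
  have h3 : v j = 0 := by
    have : ε ^ 2 * (1 - ε) * v j = 0 := by linear_combination h1' - h2'
    exact (mul_eq_zero.1 this).resolve_left
      (mul_ne_zero (pow_ne_zero 2 hε.ne') (by linarith))
  have h4 : v u = 0 := by simpa [h3] using h1'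
  refine hv0 (funext fun x => ?_)
  by_cases hxj : x = j
  · rw [hxj, h3, Pi.zero_apply]
  by_cases hxu : x = u
  · rw [hxu, h4, Pi.zero_apply]
  exact hoff x hxj hxu

end SingleEdge

/-! ### Zariski density of the parameter space and regularity of the cumulants. -/

section ParameterSpace

variable {V : Type*} {G : Digraph V}

theorem edgeMatrix_of_adj (θ : ParamIdx G → ℝ) {i j : V} (h : G.Adj i j) :
    edgeMatrix θ j i = θ (.edge i j h) := by
  simp [edgeMatrix, h]

theorem edgeMatrix_of_not_adj (θ : ParamIdx G → ℝ) {i j : V} (h : ¬ G.Adj i j) :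
    edgeMatrix θ j i = 0 := by
  simp [edgeMatrix, h]

/-- The parameter with edge matrix `B` and noise cumulants equal to one. -/
def unitNoiseParam (G : Digraph V) (B : Matrix V V ℝ) : ParamIdx G → ℝ
  | .edge i j _ => B j i
  | .noise2 _ => 1
  | .noise3 _ => 1
  | .noise4 _ => 1

theorem edgeMatrix_unitNoiseParam {B : Matrix V V ℝ} (hB : ∀ i j, ¬ G.Adj i j → B j i = 0) :
    edgeMatrix (unitNoiseParam G B) = B := by
  ext j i
  by_cases h : G.Adj i j
  · rw [edgeMatrix_of_adj _ h]
    rfl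
  · rw [edgeMatrix_of_not_adj _ h, hB i j h]

theorem edgeMatrix_unitNoiseParam_zero : edgeMatrix (unitNoiseParam G 0) = 0 :=
  edgeMatrix_unitNoiseParam fun _ _ _ => rfl

variable [Fintype V] [DecidableEq V]

instance : Finite (ParamIdx G) := by
  refine Finite.of_surjective
    (fun x : (Σ i, {j // G.Adj i j}) ⊕ V ⊕ V ⊕ V => (match x with
      | .inl e => .edge e.1 e.2.1 e.2.2
      | .inr (.inl i) => .noise2 i
      | .inr (.inr (.inl i)) => .noise3 i
      | .inr (.inr (.inr i)) => .noise4 i : ParamIdx G)) ?_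
  rintro (⟨i, j, h⟩ | i | i | i)
  exacts [⟨.inl ⟨i, j, h⟩, rfl⟩, ⟨.inr (.inl i), rfl⟩, ⟨.inr (.inr (.inl i)), rfl⟩,
    ⟨.inr (.inr (.inr i)), rfl⟩]

theorem mem_paramSpace_of_abs_lt {θ : ParamIdx G → ℝ}
    (he : ∀ i j h, |θ (.edge i j h)| < ((Fintype.card V : ℝ) + 1)⁻¹)
    (h2 : ∀ i, 0 < θ (.noise2 i)) (h3 : ∀ i, θ (.noise3 i) ≠ 0) (h4 : ∀ i, 0 < θ (.noise4 i)) :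
    θ ∈ paramSpace G := by
  refine ⟨schurStable_of_abs_lt fun j i => ?_, h2, h3, h4⟩
  by_cases h : G.Adj i j
  · rw [edgeMatrix_of_adj θ h]
    exact he i j h
  · rw [edgeMatrix_of_not_adj θ h, abs_zero]
    positivity

theorem zariskiDense_paramSpace : ZariskiDense (paramSpace G) := by
  intro P hP
  set ε : ℝ := ((Fintype.card V : ℝ) + 1)⁻¹
  have hε : 0 < ε := by positivity
  -- The parameter space contains a product of infinite sets, small intervals for the edge weights
  -- and half-lines for the noise.
  refine MvPolynomial.funext_set (fun x : ParamIdx G => match x with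
      | .edge _ _ _ => Set.Ioo (-ε) ε
      | _ => Set.Ioi 0) ?_ ?_
  · rintro (_ | _ | _ | _)
    · exact Set.Ioo_infinite (by linarith)
    all_goals exact Set.Ioi_infinite 0
  · intro θ hθ
    rw [map_zero]
    exact hP ⟨θ, mem_paramSpace_of_abs_lt (fun i j h => abs_lt.2 (hθ (.edge i j h) trivial))
      (fun i => hθ (.noise2 i) trivial) (fun i => (show 0 < θ (.noise3 i) from hθ (.noise3 i) trivial).ne')
      (fun i => hθ (.noise4 i) trivial)⟩

theorem unitNoiseParam_mem {B : Matrix V V ℝ}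
    (hB : ∀ i j, |B i j| < ((Fintype.card V : ℝ) + 1)⁻¹) : unitNoiseParam G B ∈ paramSpace G :=
  mem_paramSpace_of_abs_lt (fun i j _ => hB j i) (fun _ => one_pos) (fun _ => one_ne_zero)
    fun _ => one_pos

theorem zero_param_mem : unitNoiseParam G 0 ∈ paramSpace G :=
  unitNoiseParam_mem fun i j => by
    rw [Matrix.zero_apply, abs_zero]
    positivity

theorem paramSpace_nonempty : (paramSpace G).Nonempty := ⟨_, zero_param_mem⟩

/-- For every edge there is a parameter whose matrix is supported on the diagonal and at that
edge. -/
theorem exists_singleEdge_param (hG : ∀ i, G.Adj i i) {u j : V} (h : G.Adj u j) :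
    ∃ ε : ℝ, 0 < ε ∧ ε < 1 ∧ unitNoiseParam G (singleEdgeMatrix u j ε) ∈ paramSpace G ∧
      edgeMatrix (unitNoiseParam G (singleEdgeMatrix u j ε)) = singleEdgeMatrix u j ε := by
  have hc : (0 : ℝ) ≤ Fintype.card V := by positivity
  refine ⟨((Fintype.card V : ℝ) + 2)⁻¹, by positivity, inv_lt_one_of_one_lt₀ (by linarith),
    unitNoiseParam_mem fun x y => ?_, edgeMatrix_unitNoiseParam fun x y hxy => ?_⟩
  · have h1 : ((Fintype.card V : ℝ) + 2)⁻¹ < ((Fintype.card V : ℝ) + 1)⁻¹ :=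
      inv_strictAnti₀ (by linarith) (by linarith)
    have h0 : (0 : ℝ) < ((Fintype.card V : ℝ) + 2)⁻¹ := by positivity
    simp only [singleEdgeMatrix, Matrix.of_apply]
    split_ifs <;> first | rwa [abs_of_pos h0] | (rw [abs_zero]; linarith)
  · have h1 : y ≠ x := fun h => hxy (h ▸ hG x)
    have h2 : ¬ (y = j ∧ x = u) := by
      rintro ⟨rfl, rfl⟩
      exact hxy h
    simp [singleEdgeMatrix, h1, h2]

theorem edgeMatrix_mem_regularFunctions (i j : V) :
    (fun θ : paramSpace G => edgeMatrix θ.1 j i) ∈ regularFunctions (paramSpace G) := by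
  by_cases h : G.Adj i j
  · simp only [edgeMatrix_of_adj _ h]
    exact coord_mem_regularFunctions _
  · simp only [edgeMatrix_of_not_adj _ h]
    exact zero_mem _

theorem isLyapunovSolution_lyapunovCumulant {n : ℕ} [NeZero n] {A : Matrix V V ℝ}
    (hA : SchurStable A) (w : V → ℝ) :
    IsLyapunovSolution (n := n) (lyapunovCumulant A (diagTensor w)) A w :=
  fun i => hA.lyapunovCumulant_eq _ i

theorem lyapunovCumulant_mem_regularFunctions {n : ℕ} [NeZero n]
    {w : paramSpace G → V → ℝ} (hw : ∀ v, (fun θ => w θ v) ∈ regularFunctions (paramSpace G))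
    (i : Fin n → V) :
    (fun θ : paramSpace G => lyapunovCumulant (edgeMatrix θ.1) (diagTensor (w θ)) i) ∈
      regularFunctions (paramSpace G) := by
  classical
  have hM : ∀ k l, (fun θ : paramSpace G => (1 - tuckerMatrix n (edgeMatrix θ.1)) k l) ∈
      regularFunctions (paramSpace G) := by
    intro k l
    refine sub_mem (H := regularFunctions (paramSpace G))
      (x := fun _ => (1 : Matrix (Fin n → V) (Fin n → V) ℝ) k l)
      ((regularFunctions (paramSpace G)).algebraMap_mem _) ?_
    have : (fun θ : paramSpace G => tuckerMatrix n (edgeMatrix θ.1) k l) =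
        ∏ r, fun θ : paramSpace G => edgeMatrix θ.1 (k r) (l r) := by
      funext θ
      simp [tuckerMatrix]
    rw [this]
    exact prod_mem fun r _ => edgeMatrix_mem_regularFunctions _ _
  refine mem_regularFunctions_of_mul (det_mem_subalgebra _ hM)
    (fun θ => θ.2.1.det_one_sub_tuckerMatrix_ne_zero) ?_
  have : ((fun θ : paramSpace G => (1 - tuckerMatrix n (edgeMatrix θ.1)).det) *
      fun θ : paramSpace G => lyapunovCumulant (edgeMatrix θ.1) (diagTensor (w θ)) i) =
      fun θ : paramSpace G =>
        ((1 - tuckerMatrix n (edgeMatrix θ.1)).updateCol i (diagTensor (w θ))).det := by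
    funext θ
    exact θ.2.1.det_mul_lyapunovCumulant _ i
  rw [this]
  refine det_mem_subalgebra _ fun k l => ?_
  by_cases hl : l = i
  · subst hl
    simp only [Matrix.updateCol_self]
    have : (fun θ : paramSpace G => diagTensor (w θ) k) =
        ∑ v, if ∀ r, k r = v then (fun θ => w θ v) else 0 := by
      funext θ
      rw [Finset.sum_apply, diagTensor]
      refine Finset.sum_congr rfl fun v _ => ?_
      split_ifs <;> rfl
    rw [this]
    refine sum_mem fun v _ => ?_
    split_ifs
    · exact hw v
    · exact zero_mem _
  · simpa [Matrix.updateCol_ne hl] using hM k l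

theorem cumulantMap_mem_regularFunctions (t : CumulantIdx V) :
    (fun θ : paramSpace G => cumulantMap G θ.1 t) ∈ regularFunctions (paramSpace G) := by
  cases t <;>
  exact lyapunovCumulant_mem_regularFunctions (fun v => coord_mem_regularFunctions _) _

end ParameterSpace

/-! ### Graph order, source slices and recovery of the parameters. -/

section Identification

variable {V : Type*}

/-- The edge relation without self-loops. -/
def StrictAdj (G : Digraph V) (a b : V) : Prop := a ≠ b ∧ G.Adj a b

variable {G : Digraph V}

theorem AcyclicUpToLoops.wellFounded_transGen [Finite V] (hG : AcyclicUpToLoops G) :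
    WellFounded (Relation.TransGen (StrictAdj G)) := by
  have : Std.Irrefl (Relation.TransGen (StrictAdj G)) := ⟨hG⟩
  exact Finite.wellFounded_of_trans_of_irrefl _

/-- A node `v` with a proper child has a proper child `k` none of whose other parents is a
descendant of `v`. -/
theorem AcyclicUpToLoops.exists_first_child [Finite V] (hG : AcyclicUpToLoops G) {v j : V}
    (hvj : StrictAdj G v j) : ∃ k, StrictAdj G v k ∧
      ∀ y, StrictAdj G y k → y ≠ v → ¬ Relation.ReflTransGen (StrictAdj G) v y := by
  -- Take `k` minimal among the proper descendants of `v`; a parent of `k` that is itself a proper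
  -- descendant would contradict minimality.
  obtain ⟨k, hk, hmin⟩ := hG.wellFounded_transGen.has_min
    {k | Relation.TransGen (StrictAdj G) v k} ⟨j, .single hvj⟩
  have h : ∀ y, StrictAdj G y k → y ≠ v → ¬ Relation.ReflTransGen (StrictAdj G) v y := by
    intro y hy hyv hvy
    rcases Relation.reflTransGen_iff_eq_or_transGen.1 hvy with h | h
    · exact hyv h
    · exact hmin y h (.single hy)
  obtain ⟨y, hvy, hyk⟩ := Relation.TransGen.tail'_iff.1 hk
  by_cases hyv : y = v
  · exact ⟨k, hyv ▸ hyk, h⟩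
  · exact absurd hvy (h y hyk hyv)

theorem edgeMatrix_of_not_strictAdj (θ : ParamIdx G → ℝ) {i j : V} (hij : i ≠ j)
    (h : ¬ StrictAdj G i j) : edgeMatrix θ j i = 0 :=
  edgeMatrix_of_not_adj θ fun hadj => h ⟨hij, hadj⟩

variable [Fintype V] [DecidableEq V]

section Source

variable {m : ℕ} [NeZero m] {w : paramSpace G → V → ℝ} {v : V}

theorem lyapunovCumulant_source_slice (hv : ∀ y, ¬ StrictAdj G y v) (θ : paramSpace G) {x : V}
    (hx : x ≠ v) :
    lyapunovCumulant (n := m + 1) (edgeMatrix θ.1) (diagTensor (w θ)) (Fin.cons x fun _ => v) =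
      edgeMatrix θ.1 v v ^ m * ∑ y, lyapunovCumulant (n := m + 1) (edgeMatrix θ.1)
        (diagTensor (w θ)) (Fin.cons y fun _ => v) * edgeMatrix θ.1 x y := by
  rw [(isLyapunovSolution_lyapunovCumulant θ.2.1 (w θ)).cons_of_ne hx, Finset.mul_sum]
  refine Finset.sum_congr rfl fun y _ => ?_
  rw [contract_of_row_eq_zero _ fun y hy => edgeMatrix_of_not_strictAdj _ hy (hv y)]
  ring

/-- Slices at a source vanish outside of its descendants. -/
theorem lyapunovCumulant_source_slice_eq_zero (hG : AcyclicUpToLoops G)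
    (hw : ∀ x, (fun θ => w θ x) ∈ regularFunctions (paramSpace G))
    (hv : ∀ y, ¬ StrictAdj G y v) (x : V) (hx : ¬ Relation.ReflTransGen (StrictAdj G) v x)
    (θ : paramSpace G) :
    lyapunovCumulant (n := m + 1) (edgeMatrix θ.1) (diagTensor (w θ)) (Fin.cons x fun _ => v) =
      0 := by
  induction x using hG.wellFounded_transGen.induction generalizing θ with
  | h x ih =>
    have hxv : x ≠ v := fun h => hx (h ▸ .refl)
    let f : paramSpace G → ℝ := fun θ =>
      1 - edgeMatrix θ.1 v v ^ m * edgeMatrix θ.1 x x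
    let t : paramSpace G → ℝ := fun θ =>
      lyapunovCumulant (n := m + 1) (edgeMatrix θ.1) (diagTensor (w θ)) (Fin.cons x fun _ => v)
    have hf : f ∈ regularFunctions (paramSpace G) :=
      sub_mem (one_mem _) (mul_mem (pow_mem (edgeMatrix_mem_regularFunctions v v) m)
        (edgeMatrix_mem_regularFunctions x x))
    -- By induction only `y = x` survives in the sum. The factor `f` is not the zero function, since
    -- it equals `1` at `A = 0`, so `t` vanishes.
    have hft : f * t = 0 := by
      funext θ
      have h := lyapunovCumulant_source_slice (m := m) (w := w) hv θ hxv
      rw [Finset.sum_eq_single x] at h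
      · simp only [f, t, Pi.mul_apply, Pi.zero_apply]
        linear_combination h
      · intro y _ hy
        by_cases hyx : StrictAdj G y x
        · rw [ih y (.single hyx) (fun h => hx (h.tail hyx)), zero_mul]
        · rw [edgeMatrix_of_not_strictAdj _ hy hyx, mul_zero]
      · simp
    rcases zariskiDense_paramSpace.mul_eq_zero hf (lyapunovCumulant_mem_regularFunctions hw _) hft
      with h | h
    · have := congrFun h ⟨_, zero_param_mem⟩
      simp [f, edgeMatrix_unitNoiseParam_zero, NeZero.ne m] at this
    · exact congrFun h θ

/-- Only `v` and `k` contribute: the slice vanishes at the other parents of `k`, which are not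
descendants of `v`. The two weights into `k` are the same for every order. -/
theorem lyapunovCumulant_first_child (hG : AcyclicUpToLoops G)
    (hw : ∀ x, (fun θ => w θ x) ∈ regularFunctions (paramSpace G))
    (hv : ∀ y, ¬ StrictAdj G y v) {k : V} (hk : StrictAdj G v k)
    (hk' : ∀ y, StrictAdj G y k → y ≠ v → ¬ Relation.ReflTransGen (StrictAdj G) v y)
    (θ : paramSpace G) :
    lyapunovCumulant (n := m + 1) (edgeMatrix θ.1) (diagTensor (w θ)) (Fin.cons k fun _ => v) =
      edgeMatrix θ.1 v v ^ m * (edgeMatrix θ.1 k v *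
        lyapunovCumulant (n := m + 1) (edgeMatrix θ.1) (diagTensor (w θ))
          (Fin.cons v fun _ => v) + edgeMatrix θ.1 k k *
        lyapunovCumulant (n := m + 1) (edgeMatrix θ.1) (diagTensor (w θ))
          (Fin.cons k fun _ => v)) := by
  conv_lhs => rw [lyapunovCumulant_source_slice hv θ hk.1.symm]
  rw [Finset.sum_eq_add v k hk.1]
  · ring
  · intro y _ hy
    by_cases hyk : StrictAdj G y k
    · rw [lyapunovCumulant_source_slice_eq_zero hG hw hv y (hk' y hyk hy.1), zero_mul]
    · rw [edgeMatrix_of_not_strictAdj _ hy.2 hyk, mul_zero]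
  · simp
  · simp

end Source

variable (G) in
/-- Functions on the parameter space that are rational in the cumulants. -/
noncomputable def identifiableFunctions : Subalgebra ℝ (paramSpace G → ℝ) :=
  rationalInValues (f := cumulantMap G) zariskiDense_paramSpace paramSpace_nonempty
    cumulantMap_mem_regularFunctions

theorem cumulant_mem_identifiableFunctions (t : CumulantIdx V) :
    (fun θ : paramSpace G => cumulantMap G θ.1 t) ∈ identifiableFunctions G :=
  value_mem_rationalInValues t

theorem isLyapunovSolution_second (θ : paramSpace G) :
    IsLyapunovSolution (fun i => cumulantMap G θ.1 (.second i)) (edgeMatrix θ.1)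
      fun v => θ.1 (.noise2 v) :=
  isLyapunovSolution_lyapunovCumulant θ.2.1 _

theorem isLyapunovSolution_third (θ : paramSpace G) :
    IsLyapunovSolution (fun i => cumulantMap G θ.1 (.third i)) (edgeMatrix θ.1)
      fun v => θ.1 (.noise3 v) :=
  isLyapunovSolution_lyapunovCumulant θ.2.1 _

theorem isLyapunovSolution_fourth (θ : paramSpace G) :
    IsLyapunovSolution (fun i => cumulantMap G θ.1 (.fourth i)) (edgeMatrix θ.1)
      fun v => θ.1 (.noise4 v) :=
  isLyapunovSolution_lyapunovCumulant θ.2.1 _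

/-- The self-loop weight at a source that has a child is identifiable. -/
theorem source_self_mem_identifiableFunctions (hG : IsDAGWithAllSelfLoops G) {v j : V}
    (hv : ∀ y, ¬ StrictAdj G y v) (hvj : StrictAdj G v j) :
    (fun θ : paramSpace G => edgeMatrix θ.1 v v) ∈ identifiableFunctions G := by
  obtain ⟨k, hk, hk'⟩ := hG.1.exists_first_child hvj
  let X₂ : paramSpace G → ℝ := fun θ => cumulantMap G θ.1 (.second (Fin.cons k fun _ => v))
  let X₃ : paramSpace G → ℝ := fun θ => cumulantMap G θ.1 (.third (Fin.cons k fun _ => v))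
  let X₄ : paramSpace G → ℝ := fun θ => cumulantMap G θ.1 (.fourth (Fin.cons k fun _ => v))
  let Y₂ : paramSpace G → ℝ := fun θ => cumulantMap G θ.1 (.second (Fin.cons v fun _ => v))
  let Y₃ : paramSpace G → ℝ := fun θ => cumulantMap G θ.1 (.third (Fin.cons v fun _ => v))
  let Y₄ : paramSpace G → ℝ := fun θ => cumulantMap G θ.1 (.fourth (Fin.cons v fun _ => v))
  let a : paramSpace G → ℝ := fun θ => edgeMatrix θ.1 v v
  have hX₂ : X₂ ∈ identifiableFunctions G := cumulant_mem_identifiableFunctions _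
  have hX₃ : X₃ ∈ identifiableFunctions G := cumulant_mem_identifiableFunctions _
  have hX₄ : X₄ ∈ identifiableFunctions G := cumulant_mem_identifiableFunctions _
  have hY₂ : Y₂ ∈ identifiableFunctions G := cumulant_mem_identifiableFunctions _
  have hY₃ : Y₃ ∈ identifiableFunctions G := cumulant_mem_identifiableFunctions _
  have hY₄ : Y₄ ∈ identifiableFunctions G := cumulant_mem_identifiableFunctions _
  have ha : a ∈ regularFunctions (paramSpace G) := edgeMatrix_mem_regularFunctions v v
  have hr : X₂ * (Y₃ * X₄ - X₃ * Y₄) ∈ identifiableFunctions G :=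
    mul_mem hX₂ (sub_mem (mul_mem hY₃ hX₄) (mul_mem hX₃ hY₄))
  have hs : X₄ * (Y₂ * X₃ - X₂ * Y₃) ∈ identifiableFunctions G :=
    mul_mem hX₄ (sub_mem (mul_mem hY₂ hX₃) (mul_mem hX₂ hY₃))
  -- Eliminating the weights `v → k` and `k → k` from the three equations gives a quadratic in `a`
  -- with coefficients in the cumulants. It has the spurious root `1`; the other factor is linear.
  -- The multipliers below are 2 × 2 minors times powers of `a`, so nothing is divided by `a`.
  have hzero : (a - 1) * (X₂ * (Y₃ * X₄ - X₃ * Y₄) * a - X₄ * (Y₂ * X₃ - X₂ * Y₃)) = 0 := by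
    funext θ
    have h2 : X₂ θ = a θ ^ 1 * (edgeMatrix θ.1 k v * Y₂ θ + edgeMatrix θ.1 k k * X₂ θ) :=
      lyapunovCumulant_first_child (m := 1) (w := fun θ x => θ.1 (ParamIdx.noise2 x)) hG.1
        (fun x => coord_mem_regularFunctions (ParamIdx.noise2 x)) hv hk hk' θ
    have h3 : X₃ θ = a θ ^ 2 * (edgeMatrix θ.1 k v * Y₃ θ + edgeMatrix θ.1 k k * X₃ θ) :=
      lyapunovCumulant_first_child (m := 2) (w := fun θ x => θ.1 (ParamIdx.noise3 x)) hG.1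
        (fun x => coord_mem_regularFunctions (ParamIdx.noise3 x)) hv hk hk' θ
    have h4 : X₄ θ = a θ ^ 3 * (edgeMatrix θ.1 k v * Y₄ θ + edgeMatrix θ.1 k k * X₄ θ) :=
      lyapunovCumulant_first_child (m := 3) (w := fun θ x => θ.1 (ParamIdx.noise4 x)) hG.1
        (fun x => coord_mem_regularFunctions (ParamIdx.noise4 x)) hv hk hk' θ
    simp only [Pi.mul_apply, Pi.sub_apply, Pi.one_apply, Pi.zero_apply]
    linear_combination (a θ ^ 2 * (Y₃ θ * X₄ θ - X₃ θ * Y₄ θ)) * h2 -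
      (a θ * (Y₂ θ * X₄ θ - X₂ θ * Y₄ θ)) * h3 + (Y₂ θ * X₃ θ - X₂ θ * Y₃ θ) * h4
  have heq : X₂ * (Y₃ * X₄ - X₃ * Y₄) * a = X₄ * (Y₂ * X₃ - X₂ * Y₃) := by
    rcases zariskiDense_paramSpace.mul_eq_zero (sub_mem ha (one_mem _))
      (sub_mem (mul_mem hr.1 ha) hs.1) hzero with h | h
    · have := congrFun h ⟨_, zero_param_mem⟩
      simp [a, edgeMatrix_unitNoiseParam_zero] at this
    · exact sub_eq_zero.1 h
  refine mem_rationalInValues_of_mul ha hr (fun h0 => ?_) (heq ▸ hs)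
  -- The coefficient of `a` is tested at the matrix of the edge `v → k`, where each `X` is `ε` to
  -- its order times the corresponding `Y`.
  obtain ⟨ε, hε, hε1, hmem, hA⟩ := exists_singleEdge_param hG.2 hk.2
  have h0' := congrFun h0 ⟨_, hmem⟩
  have hS := isLyapunovSolution_second (G := G) ⟨_, hmem⟩
  have hT := isLyapunovSolution_third (G := G) ⟨_, hmem⟩
  have hR := isLyapunovSolution_fourth (G := G) ⟨_, hmem⟩
  simp only [hA] at hS hT hR
  have hY2 := hS.singleEdge_self_ne_zero hk.1 one_ne_zero
  have hY3 := hT.singleEdge_self_ne_zero hk.1 one_ne_zero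
  have hY4 := hR.singleEdge_self_ne_zero hk.1 one_ne_zero
  simp only [X₂, X₃, X₄, Y₃, Y₄, Pi.mul_apply, Pi.sub_apply, Pi.zero_apply,
    hS.singleEdge_target hk.1 hk.1, hT.singleEdge_target hk.1 hk.1,
    hR.singleEdge_target hk.1 hk.1] at h0'
  have hfac : ∀ s t r : ℝ, ε ^ (1 + 1) * s * (t * (ε ^ (3 + 1) * r) - ε ^ (2 + 1) * t * r) =
      ε ^ 5 * (ε - 1) * s * t * r := fun s t r => by ring
  rw [hfac] at h0'
  exact mul_ne_zero (mul_ne_zero (mul_ne_zero (mul_ne_zero (pow_ne_zero 5 hε.ne') (by linarith))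
    hY2) hY3) hY4 h0'

/-- If `j` has a proper parent, row `j` is identifiable when the rows of its parents are. -/
theorem row_mem_identifiableFunctions (hG : IsDAGWithAllSelfLoops G) {u j : V}
    (huj : StrictAdj G u j)
    (ih : ∀ x, StrictAdj G x j → ∀ y,
      (fun θ : paramSpace G => edgeMatrix θ.1 x y) ∈ identifiableFunctions G) (y : V) :
    (fun θ : paramSpace G => edgeMatrix θ.1 j y) ∈ identifiableFunctions G := by
  classical
  obtain ⟨ε, hε, hε1, hmem, hA⟩ := exists_singleEdge_param hG.2 huj.2
  -- A square system indexed by `V`: second-order equations at the parents of `j`, zero entries at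
  -- the non-parents other than `j`, and the third-order equation at `u` in the slot `j`, left free
  -- because the equation at `(j, j)` involves the noise.
  refine mem_rationalInValues_of_mulVec
    (M := fun θ : paramSpace G => Matrix.of fun x y =>
      if x = j then contract (fun i => cumulantMap G θ.1 (.third i)) (edgeMatrix θ.1) u y
      else if StrictAdj G x j then
        contract (fun i => cumulantMap G θ.1 (.second i)) (edgeMatrix θ.1) x y
      else (1 : Matrix V V ℝ) x y)
    (x := fun θ y => edgeMatrix θ.1 j y)
    (b := fun θ x => if x = j then cumulantMap G θ.1 (.third (Fin.cons j fun _ => u))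
      else if StrictAdj G x j then cumulantMap G θ.1 (.second (Fin.cons j fun _ => x)) else 0)
    ?_ ?_ (fun y => edgeMatrix_mem_regularFunctions y j) ?_ (θ₀ := ⟨_, hmem⟩) ?_ y
  · intro x y
    simp only [Matrix.of_apply]
    split_ifs with h1 h2
    · exact contract_mem_subalgebra _ (fun _ => cumulant_mem_identifiableFunctions _) (ih u huj) y
    · exact contract_mem_subalgebra _ (fun _ => cumulant_mem_identifiableFunctions _) (ih x h2) y
    · exact (identifiableFunctions G).algebraMap_mem _
  · intro x
    split_ifs
    · exact cumulant_mem_identifiableFunctions _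
    · exact cumulant_mem_identifiableFunctions _
    · exact zero_mem _
  · intro θ
    funext x
    simp only [Matrix.mulVec, dotProduct, Matrix.of_apply]
    split_ifs with h1 h2
    · exact ((isLyapunovSolution_third θ).cons_of_ne huj.1.symm).symm
    · exact ((isLyapunovSolution_second θ).cons_of_ne h2.1.symm).symm
    · simpa [Matrix.one_apply] using edgeMatrix_of_not_strictAdj θ.1 h1 h2
  · have hS := isLyapunovSolution_second (G := G) ⟨_, hmem⟩
    have hT := isLyapunovSolution_third (G := G) ⟨_, hmem⟩
    simp only [hA] at hS hT ⊢
    exact det_rowSystem_singleEdge_ne_zero hS hT huj.1 hε hε1 (fun _ => one_ne_zero)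
      (fun _ => one_ne_zero) (fun x => StrictAdj G x j) huj

theorem edgeMatrix_mem_identifiableFunctions (hG : IsDAGWithAllSelfLoops G)
    (hiso : NoIsolatedNodes G) (j y : V) :
    (fun θ : paramSpace G => edgeMatrix θ.1 j y) ∈ identifiableFunctions G := by
  induction j using hG.1.wellFounded_transGen.induction generalizing y with
  | h j ih =>
    by_cases hpar : ∃ u, StrictAdj G u j
    · obtain ⟨u, hu⟩ := hpar
      exact row_mem_identifiableFunctions hG hu (fun x hx y => ih x (.single hx) y) y
    · push Not at hpar
      by_cases hy : y = j
      · subst hy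
        -- A source has no parent, so its neighbour is a child, as the source case requires.
        obtain ⟨k, hk, h | h⟩ := hiso y
        · exact source_self_mem_identifiableFunctions hG hpar ⟨hk.symm, h⟩
        · exact absurd ⟨hk, h⟩ (hpar k)
      · simp only [edgeMatrix_of_not_strictAdj _ hy (hpar y)]
        exact zero_mem _

theorem param_mem_identifiableFunctions (hG : IsDAGWithAllSelfLoops G)
    (hiso : NoIsolatedNodes G) (s : ParamIdx G) :
    (fun θ : paramSpace G => θ.1 s) ∈ identifiableFunctions G := by
  have hA := edgeMatrix_mem_identifiableFunctions hG hiso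
  cases s with
  | edge i j h =>
    simp only [← edgeMatrix_of_adj _ h]
    exact hA j i
  | noise2 v =>
    exact noise_mem_of_isLyapunovSolution _ (fun _ => cumulant_mem_identifiableFunctions _) hA
      isLyapunovSolution_second v
  | noise3 v =>
    exact noise_mem_of_isLyapunovSolution _ (fun _ => cumulant_mem_identifiableFunctions _) hA
      isLyapunovSolution_third v
  | noise4 v =>
    exact noise_mem_of_isLyapunovSolution _ (fun _ => cumulant_mem_identifiableFunctions _) hA
      isLyapunovSolution_fourth v

end Identification

end DiscreteLyapunov

theorem theorem4p4 {V : Type*} [Fintype V] [DecidableEq V] (G : Digraph V)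
    (hp : 2 ≤ Fintype.card V)
    (hG : DiscreteLyapunov.IsDAGWithAllSelfLoops G)
    (hiso : DiscreteLyapunov.NoIsolatedNodes G) :
    DiscreteLyapunov.GenericallyRationallyIdentifiable
        (DiscreteLyapunov.paramSpace G) (DiscreteLyapunov.cumulantMap G)
        (fun θ (e : V × V) => DiscreteLyapunov.edgeMatrix θ e.1 e.2) ∧
      DiscreteLyapunov.GenericallyRationallyIdentifiable
        (DiscreteLyapunov.paramSpace G) (DiscreteLyapunov.cumulantMap G)
        (fun θ => θ) :=
  ⟨DiscreteLyapunov.genericallyRationallyIdentifiable_of_mem fun e =>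
      DiscreteLyapunov.edgeMatrix_mem_identifiableFunctions hG hiso e.1 e.2,
    DiscreteLyapunov.genericallyRationallyIdentifiable_of_mem fun s =>
      DiscreteLyapunov.param_mem_identifiableFunctions hG hiso s⟩
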